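/- Let $\mathsf A$ be a finite alphabet and let $(X_k)_{k\ge1}$ be the coordinate process on $\Omega=\mathsf A^{\mathbb N}$; write $x_{m:n}$ for a word $(x_m,\dots,x_n)$ and $\mathbf P(x_{1:n})=\mathbf P(X_{1:n}=x_{1:n})$. For $r\ge0$ let $\Theta^r$ be the set of laws of time homogeneous Markov chains of order at most $r$, that is, of all probability measures $\mathbf P$ on $\Omega$ for which there are transition probabilities $p(\cdot\,|\,a_{1:r})$ on $\mathsf A$ (for $a_{1:r}\in\mathsf A^r$) with $\mathbf P(x_{1:n})=\mathbf P(x_{1:r})\prod_{i=r+1}^n p(x_i\,|\,x_{i-r:i-1})$ for all $n\ge r$ and $x_{1:n}\in\mathsf A^n$. The order of a Markov chain $\mathbf P$ is the smallest $r$ with $\mathbf P\in\Theta^r$. For a word $a_{1:r}$ let $N_n(a_{1:r})=\sum_{i=r+1}^n \mathbf 1_{x_{i-r:i-1}=a_{1:r}}$. A law $\mathbf P^\star$ is said to satisfy *large-scale typicality* with cutoff $\rho(n)$ and constant $\eta<1$ if, $\mathbf P^\star$-a.s., for all sufficiently large $n$, $$\left|\frac{1}{\mathbf P^\star(a_{1:r})}\frac{N_n(a_{1:r})}{n-r}-1\right|<\eta\quad\text{for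 all } r<\rho(n) \text{ and } a_{1:r}\in\mathsf A^r \text{ with } \mathbf P^\star(a_{1:r})>0.$$ **Theorem.** For every $\eta<1$ there is a nonrandom constant $C_0>0$, depending only on $\eta$, with the following property. Let $\mathbf P^\star$ be a stationary irreducible Markov chain of order $r^\star$ with finite alphabet $\mathsf A$ (irreducible means that the chain of $r^\star$-blocks is irreducible on the set of blocks of positive probability), and let $\kappa:\mathbb N\to\mathbb R$ be a nondecreasing function with $\kappa(n)\le n/4$ such that $\mathbf P^\star$ satisfies large-scale typicality with cutoff $\rho(n)=\kappa(2n)$ and constant $\eta$. Then, $\mathbf P^\star$-a.s., for all sufficiently large $n$, $$\sup_{r^\star<r<\kappa(n)}\frac{1}{|\mathsf A|^r}\left\{\sup_{\mathbf P\in\Theta^r}\log\mathbf P(x_{1:n})-\sup_{\mathbf P\in\Theta^{r^\star}}\log\mathbf P(x_{1:n})\right\}\le C_0\log\log n,$$ where $x_{1:n}=X_{1:n}$ is the observed path and $\log 0=-\infty$ (a supremum over the empty set is $-\infty$). -/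

import Mathlib

open MeasureTheory Filter

/-- The event that the word `a` (of length `r`) is read off the path starting at position `k`.
Paths are `ω : ℕ → A`, and `ω i` is the observation number `i + 1`. -/
def wordAt {A : Type*} {r : ℕ} (k : ℕ) (a : Fin r → A) : Set (ℕ → A) :=
  {ω | ∀ t : Fin r, ω (k + t) = a t}

/-- The word of length `r` that is read off the path `ω` starting at position `k`. -/
def subword {A : Type*} (ω : ℕ → A) (k r : ℕ) : Fin r → A := fun t => ω (k + t)

/-- The event that the first `n` observations coincide with those of `ω`; its probability under
`P` is the likelihood `P(x_{1:n})` of the observed path `x = ω`. -/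
def prefixEvent {A : Type*} (n : ℕ) (ω : ℕ → A) : Set (ℕ → A) :=
  wordAt 0 (subword ω 0 n)

/-- The laws of time homogeneous Markov chains of order at most `r` on the alphabet `A`: there
are transition probabilities `p (a_{1:r}) (a_{r+1})`, the same at all times, such that
`P(x_{1:n}) = P(x_{1:r}) ∏_{i=r+1}^n p (x_{i-r:i-1}) (x_i)` for all `n = r + m ≥ r`.
Every word in `A^n` is the beginning of some path `x`. -/
def markovLaws (A : Type*) [MeasurableSpace A] (r : ℕ) : Set (Measure (ℕ → A)) :=
  {P | IsProbabilityMeasure P ∧ ∃ p : (Fin r → A) → PMF A, ∀ (m : ℕ) (x : ℕ → A),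
    P (prefixEvent (r + m) x) =
      P (prefixEvent r x) * ∏ j ∈ Finset.range m, p (subword x j r) (x (j + r))}

/-- `P` is a Markov chain of order (exactly) `r`. -/
def IsMarkovOfOrder {A : Type*} [MeasurableSpace A] (P : Measure (ℕ → A)) (r : ℕ) : Prop :=
  IsLeast {s : ℕ | P ∈ markovLaws A s} r

/-- Stationarity: the law is invariant under the time shift. -/
def IsStationaryLaw {A : Type*} [MeasurableSpace A] (P : Measure (ℕ → A)) : Prop :=
  P.map (fun ω i => ω (i + 1)) = P

/-- Irreducibility of a chain of order `r`: the chain of `r`-blocks is irreducible on the set of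
blocks which it visits, that is, any such block `b` can be reached from any such block `a`. -/
def IsIrreducibleLaw {A : Type*} [MeasurableSpace A] (P : Measure (ℕ → A)) (r : ℕ) : Prop :=
  ∀ a b : Fin r → A, (∃ i, 0 < P (wordAt i a)) → (∃ j, 0 < P (wordAt j b)) →
    ∃ i k, 0 < P (wordAt i a ∩ wordAt (i + k) b)

/-- `N_n(a_{1:r})`: the number of occurrences of the word `a` in `x_{1:n-1}`, where `x = ω`. -/
noncomputable def wordCount {A : Type*} {r : ℕ} (n : ℕ) (a : Fin r → A) (ω : ℕ → A) : ℕ :=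
  ∑ j ∈ Finset.range (n - r), (wordAt j a).indicator (fun _ => 1) ω

/-- Large-scale typicality with cutoff `ρ` and constant `η`. -/
def LargeScaleTypicality {A : Type*} [MeasurableSpace A] (P : Measure (ℕ → A))
    (ρ : ℕ → ℝ) (η : ℝ) : Prop :=
  ∀ᵐ ω ∂P, ∀ᶠ n : ℕ in atTop, ∀ r : ℕ, (r : ℝ) < ρ n → ∀ a : Fin r → A,
    0 < P (wordAt 0 a) →
      |1 / P.real (wordAt 0 a) * ((wordCount n a ω : ℝ) / ((n : ℝ) - (r : ℝ))) - 1| < η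

/-- The maximal log-likelihood of `x_{1:n}`, `x = ω`, over the chains of order at most `r`.
It takes values in the extended reals, because `log 0 = -∞` for laws that exclude the path. -/
noncomputable def maxLogLik {A : Type*} [MeasurableSpace A] (r n : ℕ) (ω : ℕ → A) : EReal :=
  ⨆ P ∈ markovLaws A r, ENNReal.log (P (prefixEvent n ω))

/-! The true law P belongs to Θ^{r*}, so it suffices to bound Q(x_{1:n}) / P(x_{1:n}) uniformly over
Q ∈ Θ^r. View P as a chain of order r with transitions p. Apart from the initial word, whose cost
-log P(x_{1:r}) is O(r), the log-ratio is at most the sum over contexts a and letters b of i log(i /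
(Np)) - i + Np, where i counts the transitions from a to b, N the visits to a, and p = p(b|a)
(`prob_prefixEvent_mul_le`); the linear terms cancel when summed over b.

For one context and one letter, exp(l i - N p (e^l - 1)) is a supermartingale for every l. A
geometrically weighted mixture over deviation levels, with one exponent for each direction,
dominates, up to a constant factor, the exponential of a multiple of the entropy while N stays in
[sm, m] (`exists_mixture`). Maximising over Q thus costs O(1) per context, uniformly in n. Averaging
over letters gives one functional per context (`exists_count_functional`). Since each transition
moves a single context, the product over all |A|^r contexts is still a supermartingale, and Ville's
inequality controls it over a whole dyadic block of times at once (`exists_exceptional_set`).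

For block k and order r the exceptional probability is taken to be (k+1)^(-2|A|^(r-1)) 2^(-r), which
is summable. Borel-Cantelli then bounds the log-ratio by |A|^r ((16/s) log(k+1) + C), and log(k+1)
is log log n up to a constant. Typicality confines N to [sm, m] with s depending only on η, so C₀
does too; the constant C, which depends on P, is absorbed for large n. -/

/-- The relative entropy of a Poisson law of mean `i` with respect to one of mean `x`. -/
noncomputable def poissonEntropy (i x : ℝ) : ℝ := i * Real.log (i / x) - i + x

/-! ### Exponential inequalities and the mixture supermartingale for a single count. -/

theorem Real.exp_le_quadratic_of_nonpos {l : ℝ} (hl : l ≤ 0) :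
    Real.exp l ≤ 1 + l + l ^ 2 / 2 := by
  have h := Real.quadratic_le_exp_of_nonneg (x := -l) (by linarith)
  have h1 : Real.exp (-l) * Real.exp l = 1 := by rw [← Real.exp_add]; simp
  have h2 : 0 < Real.exp l := Real.exp_pos l
  have h3 : (1 + -l + (-l) ^ 2 / 2) * Real.exp l ≤ 1 := by
    exact (mul_le_mul_of_nonneg_right h h2.le).trans_eq h1
  have h4 : 0 < 1 + -l + (-l) ^ 2 / 2 := by nlinarith [sq_nonneg l]
  refine le_of_mul_le_mul_left (h3.trans ?_) h4
  nlinarith [sq_nonneg (l ^ 2)]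

/-- The function `(1 + u) log (1 + u) - u` shrinks at most quadratically under scaling. -/
theorem sq_mul_le_of_scale {s u : ℝ} (hs0 : 0 ≤ s) (hs1 : s ≤ 1) (hu : 0 ≤ u) :
    s ^ 2 * ((1 + u) * Real.log (1 + u) - u) ≤
      (1 + s * u) * Real.log (1 + s * u) - s * u := by
  let D : ℝ → ℝ := fun u => ((1 + s * u) * Real.log (1 + s * u) - s * u) -
    s ^ 2 * ((1 + u) * Real.log (1 + u) - u)
  have hder : ∀ x : ℝ, 0 ≤ x → HasDerivAt D
      (s * Real.log (1 + s * x) - s ^ 2 * Real.log (1 + x)) x := by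
    intro x hx
    have hx1 : (1 + x) ≠ 0 := by positivity
    have hx2 : (1 + s * x) ≠ 0 := by positivity
    have e1 : HasDerivAt (fun u : ℝ => 1 + u) 1 x := by
      simpa using (hasDerivAt_id x).const_add 1
    have e2 : HasDerivAt (fun u : ℝ => 1 + s * u) s x := by
      simpa using ((hasDerivAt_id x).const_mul s).const_add 1
    have e3 : HasDerivAt (fun u : ℝ => s * u) s x := by
      simpa using ((hasDerivAt_id x).const_mul s)
    have := ((e2.mul (e2.log hx2)).sub e3).sub
      (((e1.mul (e1.log hx1)).sub (hasDerivAt_id x)).const_mul (s ^ 2))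
    refine this.congr_deriv ?_
    field_simp
    ring
  have hmono : MonotoneOn D (Set.Ici 0) := by
    refine monotoneOn_of_deriv_nonneg (convex_Ici 0)
      (fun x hx => (hder x hx).continuousAt.continuousWithinAt)
      (fun x hx => (hder x (interior_subset hx)).differentiableAt.differentiableWithinAt) ?_
    intro x hx
    have hx : 0 ≤ x := interior_subset hx
    rw [(hder x hx).deriv]
    -- Bernoulli's inequality (1 + x)^s ≤ 1 + s x makes the derivative nonnegative.
    have h := Real.log_le_log (Real.rpow_pos_of_pos (by positivity) s)
      (rpow_one_add_le_one_add_mul_self (by linarith : -1 ≤ x) hs0 hs1)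
    rw [Real.log_rpow (by positivity)] at h
    nlinarith [mul_le_mul_of_nonneg_left h hs0]
  have := hmono (Set.mem_Ici.2 le_rfl) (Set.mem_Ici.2 hu) hu
  simp only [D] at this
  simp at this
  linarith

/-- For each level `j` there is an exponent for which the exponential functional exceeds `exp j`
as soon as the upward deviation, measured by its entropy at scale `y`, exceeds `j`. -/
theorem exists_upper_exponent {y : ℝ} (hy : 0 < y) (j : ℕ) :
    ∃ l : ℝ, ∀ i x : ℝ, 0 < x → x ≤ i → x ≤ y →
      (j : ℝ) ≤ y * ((1 + (i - x) / y) * Real.log (1 + (i - x) / y) - (i - x) / y) →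
      (j : ℝ) ≤ l * i - x * (Real.exp l - 1) := by
  let φ : ℝ → ℝ := fun u => (1 + u) * Real.log (1 + u) - u
  have hder : ∀ x : ℝ, 0 ≤ x → HasDerivAt φ (Real.log (1 + x)) x := by
    intro x hx
    have hx1 : (1 + x) ≠ 0 := by positivity
    have e1 : HasDerivAt (fun u : ℝ => 1 + u) 1 x := by
      simpa using (hasDerivAt_id x).const_add 1
    have := ((e1.mul (e1.log hx1)).sub (hasDerivAt_id x))
    refine this.congr_deriv ?_
    field_simp
    ring
  have hcont : ContinuousOn φ (Set.Ici 0) :=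
    fun x hx => (hder x hx).continuousAt.continuousWithinAt
  have hmono : StrictMonoOn φ (Set.Ici 0) := by
    refine strictMonoOn_of_deriv_pos (convex_Ici 0) hcont ?_
    intro x hx
    rw [interior_Ici] at hx
    have hx : 0 < x := hx
    rw [(hder x hx.le).deriv]
    exact Real.log_pos (by linarith)
  have hφ0 : φ 0 = 0 := by simp [φ]
  obtain ⟨u, hu, hju⟩ : ∃ u, 0 ≤ u ∧ φ u = j / y := by
    set B : ℝ := Real.exp (1 + j / y) with hB
    have hB1 : 1 ≤ B := Real.one_le_exp (by positivity)
    have hBge : (j : ℝ) / y ≤ φ (B - 1) := by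
      have : φ (B - 1) = B * (1 + j / y) - (B - 1) := by
        simp only [φ, add_sub_cancel]
        rw [hB, Real.log_exp]
      rw [this]
      have : (0:ℝ) ≤ j / y := by positivity
      nlinarith
    have := intermediate_value_Icc (a := 0) (b := B - 1) (by linarith)
      (hcont.mono Set.Icc_subset_Ici_self)
    obtain ⟨u, hu, h⟩ := this ⟨by rw [hφ0]; positivity, hBge⟩
    exact ⟨u, hu.1, h⟩
  -- This is the optimal Chernoff exponent for mean y and deviation u y. A smaller mean x ≤ y with
  -- the same deviation only helps, because log (1 + u) ≤ u.
  refine ⟨Real.log (1 + u), fun i x hx hxi hxy hj => ?_⟩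
  have hw : 0 ≤ (i - x) / y := div_nonneg (by linarith) hy.le
  have huw : u ≤ (i - x) / y := by
    rw [← hmono.le_iff_le (Set.mem_Ici.2 hu) (Set.mem_Ici.2 hw), hju, div_le_iff₀ hy, mul_comm]
    exact hj
  rw [le_div_iff₀ hy] at huw
  rw [Real.exp_log (by linarith)]
  have hl : 0 ≤ Real.log (1 + u) := Real.log_nonneg (by linarith)
  have hlu : Real.log (1 + u) ≤ u := by
    have := Real.log_le_sub_one_of_pos (by linarith : 0 < 1 + u); linarith
  have hjeq : (j : ℝ) = y * ((1 + u) * Real.log (1 + u) - u) := by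
    have : φ u * y = j := by rw [hju]; field_simp
    simp only [φ] at this; linarith
  nlinarith [mul_le_mul_of_nonneg_left huw hl, mul_nonneg (sub_nonneg.2 hlu) (sub_nonneg.2 hxy)]

/-- Downward deviations are sub-Gaussian: by the quadratic bound on exp for negative arguments, the
exponent -√(2j/y) already works, and the level can be measured by the square of the deviation. -/
theorem exists_lower_exponent {y : ℝ} (hy : 0 < y) (j : ℕ) :
    ∃ l : ℝ, ∀ i x : ℝ, 0 < x → i ≤ x → x ≤ y →
      (j : ℝ) ≤ (x - i) ^ 2 / (2 * y) →
      (j : ℝ) ≤ l * i - x * (Real.exp l - 1) := by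
  refine ⟨-Real.sqrt (2 * j / y), fun i x hx hix hxy hj => ?_⟩
  set q := Real.sqrt (2 * j / y) with hq
  have hq0 : 0 ≤ q := Real.sqrt_nonneg _
  have hq2 : q ^ 2 * y = 2 * j := by
    rw [hq, Real.sq_sqrt (by positivity)]; field_simp
  have hexp := Real.exp_le_quadratic_of_nonpos (l := -q) (by linarith)
  rw [le_div_iff₀ (by positivity)] at hj
  have h1 : q * y ≤ x - i := by
    refine le_of_sq_le_sq ?_ (by linarith)
    nlinarith
  have h2 : q ^ 2 * x ≤ q ^ 2 * y := mul_le_mul_of_nonneg_left hxy (sq_nonneg q)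
  nlinarith [mul_le_mul_of_nonneg_left h1 hq0, mul_le_mul_of_nonneg_left hexp hx.le]

/-- The supermartingale property of the Poisson-compensated exponential under a Bernoulli(p) step:
with z = p(e^l - 1), it is 1 + z ≤ e^z. -/
theorem exp_step_le (p l i N : ℝ) :
    p * Real.exp (l * (i + 1) - (N + 1) * p * (Real.exp l - 1)) +
      (1 - p) * Real.exp (l * i - (N + 1) * p * (Real.exp l - 1)) ≤
    Real.exp (l * i - N * p * (Real.exp l - 1)) := by
  set z := p * (Real.exp l - 1) with hz
  have e1 : l * (i + 1) - (N + 1) * p * (Real.exp l - 1) =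
      (l * i - N * p * (Real.exp l - 1)) + (l + -z) := by rw [hz]; ring
  have e2 : l * i - (N + 1) * p * (Real.exp l - 1) =
      (l * i - N * p * (Real.exp l - 1)) + -z := by rw [hz]; ring
  rw [e1, e2, Real.exp_add, Real.exp_add l, Real.exp_add]
  have h : (1 + z) * Real.exp (-z) ≤ 1 := by
    have h1 : Real.exp z * Real.exp (-z) = 1 := by rw [← Real.exp_add]; simp
    nlinarith [Real.add_one_le_exp z, Real.exp_pos (-z)]
  have h3 := mul_le_mul_of_nonneg_left h (Real.exp_pos (l * i - N * p * (Real.exp l - 1))).le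
  calc _ = Real.exp (l * i - N * p * (Real.exp l - 1)) * ((1 + z) * Real.exp (-z)) := by
        rw [hz]; ring
    _ ≤ _ := by simpa using h3

/-- Level j has mixture weight 2^(-j) / 4 but gains e^j, and 1 - log 2 > 1/4. Rounding v down to an
integer costs at most e^(1/4) ≤ 2, which together with the 1/4 gives the factor 8. -/
theorem exp_mul_le_of_floor {v g : ℝ}
    (hg : (1 / 4) * (1 / 2) ^ ⌊v⌋₊ * Real.exp ⌊v⌋₊ ≤ g) : Real.exp (v / 4) ≤ 8 * g := by
  set j := ⌊v⌋₊
  have hjv : v < j + 1 := Nat.lt_floor_add_one v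
  have h2 : (1 / 2 : ℝ) ^ j = Real.exp (-(j * Real.log 2)) := by
    rw [Real.exp_neg, mul_comm, Real.exp_mul, Real.exp_log (by norm_num)]
    simp
  rw [h2, mul_assoc, ← Real.exp_add] at hg
  have hlog := Real.log_two_lt_d9
  have h3 : Real.exp (v / 4) ≤ Real.exp (-(j * Real.log 2) + j) * Real.exp (1 / 4) := by
    rw [← Real.exp_add]
    apply Real.exp_le_exp.2
    nlinarith [(Nat.cast_nonneg j : (0:ℝ) ≤ j)]
  have h4 : Real.exp (1 / 4) ≤ 2 := by
    have h5 : Real.exp (1 / 4) ≤ Real.exp (Real.log 2) :=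
      Real.exp_le_exp.2 (by linarith [Real.log_two_gt_d9])
    rwa [Real.exp_log (by norm_num)] at h5
  have := mul_le_mul_of_nonneg_left h4 (Real.exp_pos (-(j * Real.log 2) + j)).le
  linarith

/-- A mixture of exponential supermartingales for Bernoulli counts that dominates the
exponential of a multiple of the entropy, as long as the number of trials is of order `m`. -/
theorem exists_mixture {p : ℝ} (hp0 : 0 ≤ p) (m : ℝ) {s : ℝ} (hs : 0 < s) :
    ∃ G : ℕ → ℕ → ℝ, (∀ i N, 0 < G i N) ∧ G 0 0 ≤ 1 ∧
      (∀ i N, p * G (i + 1) (N + 1) + (1 - p) * G i (N + 1) ≤ G i N) ∧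
      ∀ i N : ℕ, i ≤ N → (p = 0 → i = 0) → s * m ≤ N → (N : ℝ) ≤ m →
        Real.exp (s / 8 * poissonEntropy i (N * p)) ≤ 8 * G i N := by
  by_cases hpm : p = 0 ∨ m ≤ 0
  · refine ⟨fun _ _ => 1, fun _ _ => one_pos, le_rfl, fun _ _ => by linarith, ?_⟩
    intro i N hiN hi _ hNm
    have h0 : poissonEntropy i (N * p) = 0 := by
      rcases hpm with h | h
      · simp [poissonEntropy, h, hi h]
      · have : N = 0 := by
          have : (N : ℝ) ≤ 0 := hNm.trans h
          exact Nat.le_zero.1 (by exact_mod_cast this)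
        have hi : i = 0 := by omega
        simp [poissonEntropy, this, hi]
    simp [h0]
  push Not at hpm
  obtain ⟨hp, hm⟩ := hpm
  have hp : 0 < p := lt_of_le_of_ne hp0 (Ne.symm hp)
  have hy : 0 < m * p := by positivity
  choose lu hlu using exists_upper_exponent hy
  choose ll hll using exists_lower_exponent hy
  let H : ℝ → ℕ → ℕ → ℝ := fun l i N => Real.exp (l * i - N * p * (Real.exp l - 1))
  have hH : ∀ l i N, p * H l (i + 1) (N + 1) + (1 - p) * H l i (N + 1) ≤ H l i N := by
    intro l i N
    simpa [H] using exp_step_le p l i N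
  -- Only finitely many pairs i ≤ N ≤ m matter, so the levels are bounded and a finite mixture
  -- suffices.
  obtain ⟨J, hJ⟩ : ∃ J : ℕ, ∀ i N : ℕ, i ≤ N → (N : ℝ) ≤ m →
      ⌊m * p * ((1 + (i - N * p) / (m * p)) * Real.log (1 + (i - N * p) / (m * p)) -
        (i - N * p) / (m * p))⌋₊ < J ∧ ⌊(N * p - i) ^ 2 / (2 * (m * p))⌋₊ < J := by
    let S : Finset (ℕ × ℕ) := Finset.range (⌊m⌋₊ + 1) ×ˢ Finset.range (⌊m⌋₊ + 1)
    let f : ℕ × ℕ → ℕ := fun t =>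
      ⌊m * p * ((1 + (t.1 - t.2 * p) / (m * p)) * Real.log (1 + (t.1 - t.2 * p) / (m * p)) -
        (t.1 - t.2 * p) / (m * p))⌋₊ + ⌊(t.2 * p - t.1) ^ 2 / (2 * (m * p))⌋₊
    refine ⟨S.sup f + 1, fun i N hiN hN => ?_⟩
    have hNm : N ≤ ⌊m⌋₊ := Nat.le_floor hN
    have hmem : (i, N) ∈ S := by simp [S]; omega
    have := Finset.le_sup (f := f) hmem
    have hf : f (i, N) < S.sup f + 1 := by omega
    exact ⟨(Nat.le_add_right _ _).trans_lt hf, (Nat.le_add_left _ _).trans_lt hf⟩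
  -- Each level carries two exponents, so the total mass is at most 2 · (1/4) · 2 = 1.
  let w : ℕ → ℝ := fun j => (1 / 4) * (1 / 2) ^ j
  have hw : ∀ j, 0 < w j := fun j => by positivity
  let G : ℕ → ℕ → ℝ := fun i N =>
    ∑ j ∈ Finset.range (J + 1), w j * (H (lu j) i N + H (ll j) i N)
  have hHpos : ∀ l i N, 0 < H l i N := fun l i N => Real.exp_pos _
  refine ⟨G, fun i N => Finset.sum_pos (fun j _ => mul_pos (hw j)
    (add_pos (hHpos _ _ _) (hHpos _ _ _))) ⟨0, by simp⟩, ?_, ?_, ?_⟩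
  · have : ∀ l, H l 0 0 = 1 := fun l => by simp [H]
    simp only [G, this, w]
    rw [← Finset.sum_mul, ← Finset.mul_sum]
    have := geom_sum_eq (by norm_num : (1 / 2 : ℝ) ≠ 1) (J + 1)
    rw [this]
    have : (0 : ℝ) < (1 / 2) ^ (J + 1) := by positivity
    ring_nf at this ⊢
    linarith
  · intro i N
    simp only [G]
    rw [Finset.mul_sum, Finset.mul_sum, ← Finset.sum_add_distrib]
    refine Finset.sum_le_sum fun j _ => ?_
    have := mul_le_mul_of_nonneg_left (add_le_add (hH (lu j) i N) (hH (ll j) i N)) (hw j).le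
    linarith
  · intro i N hiN _ hsN hNm
    have hN : 0 < (N : ℝ) := lt_of_lt_of_le (by positivity) hsN
    set x := N * p with hx
    have hxpos : 0 < x := by positivity
    have hxy : x ≤ m * p := mul_le_mul_of_nonneg_right hNm hp0
    have hsx : s * (m * p) ≤ x := by
      rw [← mul_assoc]; exact mul_le_mul_of_nonneg_right hsN hp0
    obtain ⟨hJ1, hJ2⟩ := hJ i N hiN hNm
    have hGu : ∀ j < J, w j * H (lu j) i N ≤ G i N := fun j hj => by
      refine le_trans (mul_le_mul_of_nonneg_left ?_ (hw j).le)
        (Finset.single_le_sum (f := fun j => w j * (H (lu j) i N + H (ll j) i N))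
        (fun j _ => (mul_pos (hw j) (add_pos (hHpos _ _ _) (hHpos _ _ _))).le)
        (Finset.mem_range.2 (by omega : j < J + 1)))
      linarith [hHpos (ll j) i N]
    have hGl : ∀ j < J, w j * H (ll j) i N ≤ G i N := fun j hj => by
      refine le_trans (mul_le_mul_of_nonneg_left ?_ (hw j).le)
        (Finset.single_le_sum (f := fun j => w j * (H (lu j) i N + H (ll j) i N))
        (fun j _ => (mul_pos (hw j) (add_pos (hHpos _ _ _) (hHpos _ _ _))).le)
        (Finset.mem_range.2 (by omega : j < J + 1)))
      linarith [hHpos (lu j) i N]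
    rcases le_total x i with hxi | hix
    · set v := m * p * ((1 + (i - x) / (m * p)) * Real.log (1 + (i - x) / (m * p)) -
        (i - x) / (m * p)) with hv
      have hent : poissonEntropy i x =
          x * ((1 + (i - x) / x) * Real.log (1 + (i - x) / x) - (i - x) / x) := by
        have : 1 + (i - x) / x = i / x := by field_simp; ring
        rw [this, poissonEntropy]
        field_simp
        ring
      -- The level is measured at the fixed scale m p, the entropy at the current mean x = N p.
      -- Passing from one to the other loses only the factor x / (m p) ≥ s.
      have hsc := sq_mul_le_of_scale (s := x / (m * p)) (u := (i - x) / x) (by positivity)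
        (by rw [div_le_one hy]; exact hxy) (div_nonneg (by linarith) hxpos.le)
      have hsu : x / (m * p) * ((i - x) / x) = (i - x) / (m * p) := by field_simp
      rw [hsu] at hsc
      have hfu : 0 ≤ (1 + (i - x) / x) * Real.log (1 + (i - x) / x) - (i - x) / x := by
        have h1 : 0 ≤ (i - x) / x := div_nonneg (by linarith) hxpos.le
        have h2 := Real.one_sub_inv_le_log_of_pos (x := 1 + (i - x) / x) (by positivity)
        have h3 := mul_le_mul_of_nonneg_left h2 (by positivity : 0 ≤ 1 + (i - x) / x)
        rw [mul_sub, mul_inv_cancel₀ (by positivity)] at h3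
        linarith
      have hve : s * poissonEntropy i x ≤ v := by
        rw [hent, hv]
        refine le_trans ?_ (mul_le_mul_of_nonneg_left hsc hy.le)
        have : s ≤ x / (m * p) := by rw [le_div_iff₀ hy]; exact hsx
        have e : m * p * ((x / (m * p)) ^ 2 * ((1 + (i - x) / x) * Real.log (1 + (i - x) / x) -
            (i - x) / x)) = x / (m * p) * (x * ((1 + (i - x) / x) *
            Real.log (1 + (i - x) / x) - (i - x) / x)) := by
          field_simp
        rw [e]
        exact mul_le_mul_of_nonneg_right this (by positivity)
      have hent0 : 0 ≤ poissonEntropy i x := by rw [hent]; positivity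
      have hv0 : 0 ≤ v := le_trans (by positivity) hve
      have hj : Real.exp ⌊v⌋₊ ≤ H (lu ⌊v⌋₊) i N :=
        Real.exp_le_exp.2 (hlu ⌊v⌋₊ i x hxpos hxi hxy (Nat.floor_le hv0))
      have := exp_mul_le_of_floor
        ((mul_le_mul_of_nonneg_left hj (hw _).le).trans (hGu _ hJ1))
      refine le_trans (Real.exp_le_exp.2 ?_) this
      nlinarith
    · set v := (x - i) ^ 2 / (2 * (m * p)) with hv
      have hv0 : 0 ≤ v := by positivity
      have hve : s / 2 * poissonEntropy i x ≤ v := by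
        -- The χ² bound on the entropy. It leaves v ≥ (s/2) · entropy, and the further 1/4 from
        -- `exp_mul_le_of_floor` produces the s/8 of the statement.
        have h1 : poissonEntropy i x ≤ (x - i) ^ 2 / x := by
          rw [poissonEntropy, le_div_iff₀ hxpos]
          have : (i : ℝ) * Real.log (i / x) ≤ i * (i / x - 1) := by
            rcases Nat.eq_zero_or_pos i with h | h
            · simp [h]
            · have hi : (0 : ℝ) < i := by exact_mod_cast h
              exact mul_le_mul_of_nonneg_left
                (Real.log_le_sub_one_of_pos (by positivity)) hi.le
          have h2 : (i : ℝ) * (i / x - 1) * x = i * (i - x) := by field_simp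
          nlinarith [mul_le_mul_of_nonneg_right this hxpos.le]
        refine (mul_le_mul_of_nonneg_left h1 (by positivity)).trans ?_
        rw [hv, le_div_iff₀ (by positivity)]
        have : s / 2 * ((x - i) ^ 2 / x) * (2 * (m * p)) =
            (s * (m * p)) / x * (x - i) ^ 2 := by field_simp
        rw [this]
        have h3 : s * (m * p) / x ≤ 1 := by rw [div_le_one hxpos]; exact hsx
        nlinarith [sq_nonneg (x - i)]
      have hj : Real.exp ⌊v⌋₊ ≤ H (ll ⌊v⌋₊) i N :=
        Real.exp_le_exp.2 (hll ⌊v⌋₊ i x hxpos hix hxy (Nat.floor_le hv0))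
      have := exp_mul_le_of_floor
        ((mul_le_mul_of_nonneg_left hj (hw _).le).trans (hGl _ hJ2))
      refine le_trans (Real.exp_le_exp.2 ?_) this
      linarith

/-! ### Words, prefixes and transition counts. -/

section Words

variable {A : Type*}

theorem mem_prefixEvent_iff {n : ℕ} {ω ω' : ℕ → A} :
    ω' ∈ prefixEvent n ω ↔ ∀ i < n, ω' i = ω i := by
  simp only [prefixEvent, wordAt, subword, Set.mem_ofPred_eq, zero_add]
  exact ⟨fun h i hi => h ⟨i, hi⟩, fun h t => h t t.2⟩

theorem prefixEvent_congr {n : ℕ} {ω ω' : ℕ → A} (h : ∀ i < n, ω i = ω' i) :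
    prefixEvent n ω = prefixEvent n ω' := by
  ext x
  simp only [mem_prefixEvent_iff]
  exact forall₂_congr fun i hi => by rw [h i hi]

theorem prefixEvent_zero (ω : ℕ → A) : prefixEvent 0 ω = Set.univ := by
  ext x; simp [mem_prefixEvent_iff]

theorem mem_prefixEvent_succ_update {n : ℕ} {ω ω' : ℕ → A} (h : ω' ∈ prefixEvent n ω) :
    ω' ∈ prefixEvent (n + 1) (Function.update ω n (ω' n)) := by
  rw [mem_prefixEvent_iff] at h ⊢
  intro i hi
  by_cases hin : i = n
  · subst hin; simp
  · rw [Function.update_of_ne hin]; exact h i (by omega)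

theorem prefixEvent_succ_update_subset (n : ℕ) (ω : ℕ → A) (b : A) :
    prefixEvent (n + 1) (Function.update ω n b) ⊆ prefixEvent n ω := by
  intro x hx
  rw [mem_prefixEvent_iff] at hx ⊢
  intro i hi
  rw [hx i (by omega), Function.update_of_ne (by omega)]

theorem subword_congr {ω ω' : ℕ → A} {j r : ℕ} (h : ∀ t < r, ω (j + t) = ω' (j + t)) :
    subword ω j r = subword ω' j r :=
  funext fun t => h t t.2

theorem measurableSet_wordAt [MeasurableSpace A] [MeasurableSingletonClass A] {r : ℕ} (k : ℕ)
    (a : Fin r → A) : MeasurableSet (wordAt k a) := by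
  have : wordAt k a = ⋂ t : Fin r, (fun ω : ℕ → A => ω (k + t)) ⁻¹' {a t} := by
    ext; simp [wordAt]
  rw [this]
  exact MeasurableSet.iInter fun t => measurable_pi_apply _ (measurableSet_singleton _)

open Classical in
/-- The number of times the word `a` is followed by the letter `b` in the first `n` letters. -/
noncomputable def transCount (n r : ℕ) (ω : ℕ → A) (a : Fin r → A) (b : A) : ℕ :=
  {j ∈ Finset.range (n - r) | subword ω j r = a ∧ ω (j + r) = b}.card

theorem sum_transCount [Fintype A] (n r : ℕ) (ω : ℕ → A) (a : Fin r → A) :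
    ∑ b, transCount n r ω a b = wordCount n a ω := by
  classical
  have h : wordCount n a ω = {j ∈ Finset.range (n - r) | subword ω j r = a}.card := by
    rw [wordCount, Finset.card_filter]
    refine Finset.sum_congr rfl fun j _ => ?_
    have : ω ∈ wordAt j a ↔ subword ω j r = a := by
      simp only [wordAt, subword, Set.mem_ofPred_eq, funext_iff]
    simp only [Set.indicator_apply, this]
  rw [h, Finset.card_eq_sum_card_fiberwise (f := fun j => ω (j + r)) (t := Finset.univ)
    (fun _ _ => Finset.mem_coe.2 (Finset.mem_univ _))]
  refine Finset.sum_congr rfl fun b _ => ?_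
  rw [transCount, Finset.filter_filter]

theorem transCount_congr {n r : ℕ} {ω ω' : ℕ → A} (h : ∀ i < n, ω i = ω' i) :
    transCount n r ω = transCount n r ω' := by
  classical
  funext a b
  unfold transCount
  congr 1
  refine Finset.filter_congr fun j hj => ?_
  rw [Finset.mem_range] at hj
  rw [subword_congr (fun t ht => h (j + t) (by omega)), h (j + r) (by omega)]

theorem transCount_of_le {n r : ℕ} (h : n ≤ r) (ω : ℕ → A) : transCount n r ω = 0 := by
  classical
  funext a b
  simp [transCount, Nat.sub_eq_zero_of_le h]

open Classical in
theorem transCount_update (r m : ℕ) (ω : ℕ → A) (b : A) (a : Fin r → A) :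
    transCount (r + m + 1) r (Function.update ω (r + m) b) a =
      transCount (r + m) r ω a + if a = subword ω m r then Pi.single b 1 else 0 := by
  have hsw : subword (Function.update ω (r + m) b) m r = subword ω m r :=
    subword_congr fun t ht => Function.update_of_ne (by omega) _ _
  have hold : transCount (r + m) r (Function.update ω (r + m) b) = transCount (r + m) r ω :=
    transCount_congr fun i hi => Function.update_of_ne (by omega) _ _
  rw [← hold]
  funext c
  have e1 : r + m + 1 - r = m + 1 := by omega
  have e2 : r + m - r = m := by omega
  simp only [transCount, Pi.add_apply]
  rw [e1, e2, Finset.range_add_one, Finset.filter_insert, hsw, add_comm m r,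
    Function.update_self]
  by_cases h1 : a = subword ω m r
  · by_cases h2 : b = c
    · subst h2
      rw [if_pos ⟨h1.symm, rfl⟩, if_pos h1, Finset.card_insert_of_notMem (by simp)]
      simp
    · rw [if_neg (fun h => h2 h.2), if_pos h1, Pi.single_eq_of_ne (Ne.symm h2), add_zero]
  · rw [if_neg (fun h => h1 h.1.symm), if_neg h1]; simp

theorem prod_transitions [Fintype A] {M : Type*} [CommMonoid M] (r m : ℕ) (ω : ℕ → A)
    (f : (Fin r → A) → A → M) :
    ∏ j ∈ Finset.range m, f (subword ω j r) (ω (j + r)) =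
      ∏ a, ∏ b, f a b ^ transCount (r + m) r ω a b := by
  classical
  rw [← Fintype.prod_prod_type' (f := fun a b => f a b ^ transCount (r + m) r ω a b),
    ← Finset.prod_fiberwise (Finset.range m) (fun j => (subword ω j r, ω (j + r)))]
  refine Finset.prod_congr rfl fun x _ => ?_
  rw [Finset.prod_congr rfl (g := fun _ => f x.1 x.2), Finset.prod_const, transCount,
    Nat.add_sub_cancel_left]
  · congr 2
    ext j
    simp [Prod.ext_iff]
  · intro j hj
    rw [Finset.mem_filter] at hj
    rw [← hj.2]

end Words

theorem PMF.sum_toReal_eq_one {A : Type*} [Fintype A] (q : PMF A) : ∑ b, (q b).toReal = 1 := by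
  rw [← ENNReal.toReal_sum fun b _ => q.apply_ne_top b, ← tsum_fintype (L := .unconditional _),
    q.tsum_coe]
  rfl

/-! ### Ville's inequality, products over contexts, and likelihood ratios. -/

section Laws

variable {A : Type*} [MeasurableSpace A]

theorem markovLaws_mono {r s : ℕ} (h : s ≤ r) : markovLaws A s ⊆ markovLaws A r := by
  rintro P ⟨hP, p, hp⟩
  obtain ⟨d, rfl⟩ := Nat.exists_eq_add_of_le h
  refine ⟨hP, fun a => p fun t => a ⟨d + t, by omega⟩, fun m x => ?_⟩
  rw [add_assoc, hp, hp, Finset.prod_range_add, mul_assoc]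
  congr 2
  refine Finset.prod_congr rfl fun j _ => ?_
  congr 2
  · funext t
    exact congrArg x (by omega : d + j + t = j + (d + t))
  · omega

theorem prob_prefixEvent_succ_update {P : Measure (ℕ → A)} {r : ℕ} {p : (Fin r → A) → PMF A}
    (hp : ∀ (m : ℕ) (x : ℕ → A), P (prefixEvent (r + m) x) =
      P (prefixEvent r x) * ∏ j ∈ Finset.range m, p (subword x j r) (x (j + r)))
    (m : ℕ) (ω : ℕ → A) (b : A) :
    P (prefixEvent (r + m + 1) (Function.update ω (r + m) b)) =
      P (prefixEvent (r + m) ω) * p (subword ω m r) b := by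
  have h0 : prefixEvent r (Function.update ω (r + m) b) = prefixEvent r ω :=
    prefixEvent_congr fun i hi => Function.update_of_ne (by omega) _ _
  rw [add_assoc, hp, hp m, Finset.prod_range_succ, h0, mul_assoc]
  congr 2
  · refine Finset.prod_congr rfl fun j hj => ?_
    rw [Finset.mem_range] at hj
    rw [Function.update_of_ne (by omega),
      subword_congr fun t ht => Function.update_of_ne (by omega) _ _]
  · rw [add_comm m r, Function.update_self,
      subword_congr fun t ht => Function.update_of_ne (by omega) _ _]

/-- Ville's inequality for a supermartingale with respect to the filtration of the coordinates,
started from the word formed by the first `n` letters of `ω`. -/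
theorem ville_from_prefix [Fintype A] (P : Measure (ℕ → A)) (M : ℕ → (ℕ → A) → ENNReal)
    (hM : ∀ n ω ω', (∀ i < n, ω i = ω' i) → M n ω = M n ω')
    (hstep : ∀ n ω, ∑ b, P (prefixEvent (n + 1) (Function.update ω n b)) *
      M (n + 1) (Function.update ω n b) ≤ P (prefixEvent n ω) * M n ω)
    (K : ENNReal) (d : ℕ) : ∀ n ω,
    P (prefixEvent n ω ∩ {ω' | ∃ l, n ≤ l ∧ l ≤ n + d ∧ K ≤ M l ω'}) * K ≤
      P (prefixEvent n ω) * M n ω := by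
  -- Induction on the remaining horizon: either the level is already reached at time n, or the event
  -- splits according to the next letter. Only monotonicity and finite subadditivity are used, so
  -- the event need not be shown measurable.
  induction d with
  | zero =>
    intro n ω
    by_cases hK : K ≤ M n ω
    · exact mul_le_mul' (measure_mono Set.inter_subset_left) hK
    · have : prefixEvent n ω ∩ {ω' | ∃ l, n ≤ l ∧ l ≤ n + 0 ∧ K ≤ M l ω'} = ∅ := by
        rw [Set.eq_empty_iff_forall_notMem]
        rintro x ⟨hx, l, hl1, hl2, hl3⟩
        obtain rfl : l = n := by omega
        exact hK (hl3.trans_eq (hM _ _ _ (mem_prefixEvent_iff.1 hx)))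
      rw [this]
      simp
  | succ d ih =>
    intro n ω
    by_cases hK : K ≤ M n ω
    · exact mul_le_mul' (measure_mono Set.inter_subset_left) hK
    · have hsub : prefixEvent n ω ∩ {ω' | ∃ l, n ≤ l ∧ l ≤ n + (d + 1) ∧ K ≤ M l ω'} ⊆
          ⋃ b ∈ (Finset.univ : Finset A), prefixEvent (n + 1) (Function.update ω n b) ∩
            {ω' | ∃ l, n + 1 ≤ l ∧ l ≤ n + 1 + d ∧ K ≤ M l ω'} := by
        rintro x ⟨hx, l, hl1, hl2, hl3⟩
        have hln : l ≠ n := by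
          rintro rfl
          exact hK (hl3.trans_eq (hM _ _ _ (mem_prefixEvent_iff.1 hx)))
        simp only [Set.mem_iUnion]
        exact ⟨x n, Finset.mem_univ _, mem_prefixEvent_succ_update hx,
          l, by omega, by omega, hl3⟩
      calc _ ≤ (∑ b, P (prefixEvent (n + 1) (Function.update ω n b) ∩
            {ω' | ∃ l, n + 1 ≤ l ∧ l ≤ n + 1 + d ∧ K ≤ M l ω'})) * K := by
            gcongr
            exact (measure_mono hsub).trans (measure_biUnion_finset_le _ _)
        _ ≤ ∑ b, P (prefixEvent (n + 1) (Function.update ω n b)) *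
              M (n + 1) (Function.update ω n b) := by
            rw [Finset.sum_mul]
            exact Finset.sum_le_sum fun b _ => ih _ _
        _ ≤ _ := hstep n ω

theorem sum_prob_prefixEvent_succ_update_le [Fintype A] [MeasurableSingletonClass A]
    (P : Measure (ℕ → A)) (n : ℕ) (ω : ℕ → A) :
    ∑ b, P (prefixEvent (n + 1) (Function.update ω n b)) ≤ P (prefixEvent n ω) := by
  rw [← measure_biUnion_finset]
  · exact measure_mono (Set.iUnion₂_subset fun b _ => prefixEvent_succ_update_subset n ω b)
  · intro b _ c _ hbc
    refine Set.disjoint_left.2 fun x hx hx' => hbc ?_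
    rw [mem_prefixEvent_iff] at hx hx'
    have h1 := hx n (by omega)
    have h2 := hx' n (by omega)
    simp only [Function.update_self] at h1 h2
    exact h1.symm.trans h2
  · exact fun b _ => measurableSet_wordAt _ _

open Classical in
/-- A product over the contexts of nonnegative functionals of the transition counts, each of
which is a supermartingale under the transition probabilities of its context, is rarely large. -/
theorem prob_exists_le_prod_mul_le [Fintype A] [MeasurableSingletonClass A]
    {P : Measure (ℕ → A)} [IsProbabilityMeasure P] {r : ℕ} {p : (Fin r → A) → PMF A}
    (hp : ∀ (m : ℕ) (x : ℕ → A), P (prefixEvent (r + m) x) =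
      P (prefixEvent r x) * ∏ j ∈ Finset.range m, p (subword x j r) (x (j + r)))
    (F : (Fin r → A) → (A → ℕ) → ℝ) (hF : ∀ a c, 0 ≤ F a c) (hF0 : ∀ a, F a 0 ≤ 1)
    (hFstep : ∀ a c, ∑ b, (p a b).toReal * F a (c + Pi.single b 1)
      ≤ F a c) (K : ENNReal) (T : ℕ) :
    P {ω | ∃ l ≤ T, K ≤ ENNReal.ofReal (∏ a, F a (transCount l r ω a))} * K ≤ 1 := by
  let M : ℕ → (ℕ → A) → ENNReal := fun l ω => ENNReal.ofReal (∏ a, F a (transCount l r ω a))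
  have hM : ∀ n ω ω', (∀ i < n, ω i = ω' i) → M n ω = M n ω' := fun n ω ω' h => by
    simp only [M, transCount_congr h]
  have hstep : ∀ n ω, ∑ b, P (prefixEvent (n + 1) (Function.update ω n b)) *
      M (n + 1) (Function.update ω n b) ≤ P (prefixEvent n ω) * M n ω := by
    intro n ω
    -- Before time r a new letter completes no transition, so the functional is constant; afterwards
    -- only the factor of the current context a₀ changes.
    rcases lt_or_ge n r with hn | hn
    · have h1 : ∀ b, M (n + 1) (Function.update ω n b) = M n ω := fun b => by
        simp only [M, transCount_of_le (show n + 1 ≤ r from hn), transCount_of_le hn.le]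
      simp only [h1]
      rw [← Finset.sum_mul]
      exact mul_le_mul_left (sum_prob_prefixEvent_succ_update_le P n ω) _
    · obtain ⟨m, rfl⟩ := Nat.exists_eq_add_of_le hn
      simp only [prob_prefixEvent_succ_update hp, mul_assoc]
      rw [← Finset.mul_sum]
      refine mul_le_mul_right ?_ _
      set a₀ := subword ω m r with ha₀
      have h1 : ∀ b, p a₀ b * M (r + m + 1) (Function.update ω (r + m) b) =
          ENNReal.ofReal ((p a₀ b).toReal *
            (F a₀ (transCount (r + m) r ω a₀ + Pi.single b 1) *
            ∏ a ∈ Finset.univ.erase a₀, F a (transCount (r + m) r ω a))) := by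
        intro b
        rw [ENNReal.ofReal_mul ENNReal.toReal_nonneg, ENNReal.ofReal_toReal (PMF.apply_ne_top _ _)]
        congr 1
        simp only [M]
        congr 1
        rw [← Finset.mul_prod_erase _ _ (Finset.mem_univ a₀)]
        congr 1
        · rw [transCount_update, if_pos ha₀]
        · refine Finset.prod_congr rfl fun a ha => ?_
          rw [transCount_update, if_neg (Finset.ne_of_mem_erase ha), add_zero]
      rw [Finset.sum_congr rfl fun b _ => h1 b, ← ENNReal.ofReal_sum_of_nonneg]
      · refine ENNReal.ofReal_le_ofReal ?_
        simp only [← mul_assoc]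
        rw [← Finset.sum_mul, ← Finset.mul_prod_erase _ _ (Finset.mem_univ a₀)]
        exact mul_le_mul_of_nonneg_right (hFstep _ _) (Finset.prod_nonneg fun a _ => hF _ _)
      · exact fun b _ => mul_nonneg ENNReal.toReal_nonneg
          (mul_nonneg (hF _ _) (Finset.prod_nonneg fun a _ => hF _ _))
  obtain ⟨ω₀⟩ : Nonempty (ℕ → A) := P.nonempty_of_neZero
  have := ville_from_prefix P M hM hstep K T 0 ω₀
  simp only [prefixEvent_zero, Set.univ_inter, zero_le, true_and, zero_add, measure_univ,
    one_mul] at this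
  refine this.trans ?_
  simp only [M, transCount_of_le (Nat.zero_le r)]
  rw [← ENNReal.ofReal_one]
  refine ENNReal.ofReal_le_ofReal ?_
  exact Finset.prod_le_one (fun a _ => hF _ _) fun a _ => hF0 a

/-- The likelihood ratio of a chain of order `r` with respect to `P` is at most the exponential
of the total entropy of the transition counts. -/
theorem prob_prefixEvent_mul_le [Fintype A] {P Q : Measure (ℕ → A)} {r : ℕ}
    {p : (Fin r → A) → PMF A}
    (hp : ∀ (m : ℕ) (x : ℕ → A), P (prefixEvent (r + m) x) =
      P (prefixEvent r x) * ∏ j ∈ Finset.range m, p (subword x j r) (x (j + r)))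
    (hQ : Q ∈ markovLaws A r) {m : ℕ} {ω : ℕ → A}
    (hsupp : ∀ a b, p a b = 0 → transCount (r + m) r ω a b = 0) :
    Q (prefixEvent (r + m) ω) * P (prefixEvent r ω) ≤
      ENNReal.ofReal (Real.exp (∑ a, ∑ b, poissonEntropy (transCount (r + m) r ω a b)
        (wordCount (r + m) a ω * (p a b).toReal))) * P (prefixEvent (r + m) ω) := by
  obtain ⟨hQ1, q, hq⟩ := hQ
  -- This is i log(Nq/i) ≤ Nq - i, so no maximiser has to be identified. The correction N(q - p)
  -- vanishes on summing over b.
  have key : ∀ a b, (q a b).toReal ^ transCount (r + m) r ω a b ≤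
      Real.exp (poissonEntropy (transCount (r + m) r ω a b)
        (wordCount (r + m) a ω * (p a b).toReal) + wordCount (r + m) a ω *
          ((q a b).toReal - (p a b).toReal)) * (p a b).toReal ^ transCount (r + m) r ω a b := by
    intro a b
    set i := transCount (r + m) r ω a b with hi
    set N := wordCount (r + m) a ω with hN
    have hiN : i ≤ N := by
      rw [hN, ← sum_transCount]
      exact Finset.single_le_sum (f := fun b => transCount (r + m) r ω a b)
        (fun _ _ => Nat.zero_le _) (Finset.mem_univ b)
    set x := (p a b).toReal with hx
    set y := (q a b).toReal with hy
    have hx0 : 0 ≤ x := ENNReal.toReal_nonneg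
    have hy0 : 0 ≤ y := ENNReal.toReal_nonneg
    rcases Nat.eq_zero_or_pos i with h0 | hipos
    · rw [h0]
      simp only [poissonEntropy, pow_zero, mul_one, Nat.cast_zero, zero_mul, sub_zero, zero_add]
      apply Real.one_le_exp
      nlinarith [mul_nonneg (Nat.cast_nonneg N : (0:ℝ) ≤ N) hy0]
    · have hxpos : 0 < x := by
        refine ENNReal.toReal_pos (fun h => ?_) (PMF.apply_ne_top _ _)
        have := hsupp a b h
        omega
      rcases hy0.eq_or_lt with h | hypos
      · rw [← h, zero_pow (by omega)]
        positivity
      have hNpos : (0:ℝ) < N := by exact_mod_cast (by omega : 0 < N)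
      have hip : (0:ℝ) < i := by exact_mod_cast hipos
      have e1 : y ^ i = Real.exp (i * Real.log y) := by
        rw [mul_comm, Real.exp_mul, Real.exp_log hypos, Real.rpow_natCast]
      have e2 : x ^ i = Real.exp (i * Real.log x) := by
        rw [mul_comm, Real.exp_mul, Real.exp_log hxpos, Real.rpow_natCast]
      rw [e1, e2, ← Real.exp_add]
      apply Real.exp_le_exp.2
      have h1 := Real.log_le_sub_one_of_pos (by positivity : 0 < N * y / i)
      have h2 := mul_le_mul_of_nonneg_left h1 hip.le
      have h3 : (i : ℝ) * (N * y / i - 1) = N * y - i := by field_simp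
      rw [h3, Real.log_div (by positivity) hip.ne', Real.log_mul hNpos.ne' hypos.ne'] at h2
      rw [poissonEntropy, Real.log_div hip.ne' (by positivity),
        Real.log_mul hNpos.ne' hxpos.ne']
      nlinarith
  have hprod : ∏ a, ∏ b, (q a b).toReal ^ transCount (r + m) r ω a b ≤
      Real.exp (∑ a, ∑ b, poissonEntropy (transCount (r + m) r ω a b)
        (wordCount (r + m) a ω * (p a b).toReal)) *
      ∏ a, ∏ b, (p a b).toReal ^ transCount (r + m) r ω a b := by
    rw [Real.exp_sum, ← Finset.prod_mul_distrib]
    refine Finset.prod_le_prod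
      (fun a _ => Finset.prod_nonneg fun b _ => pow_nonneg ENNReal.toReal_nonneg _) fun a _ => ?_
    refine (Finset.prod_le_prod (fun b _ => pow_nonneg ENNReal.toReal_nonneg _)
      fun b _ => key a b).trans_eq ?_
    rw [Finset.prod_mul_distrib, ← Real.exp_sum, Finset.sum_add_distrib, ← Finset.mul_sum,
      Finset.sum_sub_distrib, PMF.sum_toReal_eq_one, PMF.sum_toReal_eq_one]
    simp
  have conv : ∀ f : (Fin r → A) → PMF A,
      ∏ j ∈ Finset.range m, f (subword ω j r) (ω (j + r)) =
        ENNReal.ofReal (∏ a, ∏ b, (f a b).toReal ^ transCount (r + m) r ω a b) := by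
    intro f
    rw [prod_transitions r m ω fun a b => f a b, ENNReal.ofReal_prod_of_nonneg
      fun a _ => Finset.prod_nonneg fun b _ => pow_nonneg ENNReal.toReal_nonneg _]
    refine Finset.prod_congr rfl fun a _ => ?_
    rw [ENNReal.ofReal_prod_of_nonneg fun b _ => pow_nonneg ENNReal.toReal_nonneg _]
    refine Finset.prod_congr rfl fun b _ => ?_
    rw [ENNReal.ofReal_pow ENNReal.toReal_nonneg, ENNReal.ofReal_toReal (PMF.apply_ne_top _ _)]
  -- The initial word has Q-probability at most 1; this is why P(x_{1:r}) stays on the left of the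
  -- conclusion.
  have hQle : Q (prefixEvent (r + m) ω) ≤ 1 * ENNReal.ofReal
      (∏ a, ∏ b, (q a b).toReal ^ transCount (r + m) r ω a b) := by
    rw [hq, conv q]
    exact mul_le_mul_left prob_le_one _
  rw [hp m ω, conv p, mul_left_comm, ← ENNReal.ofReal_mul (Real.exp_pos _).le, mul_comm]
  refine mul_le_mul_right (hQle.trans ?_) _
  rw [one_mul]
  exact ENNReal.ofReal_le_ofReal hprod

end Laws

/-! ### Almost sure properties of paths and lower bounds on initial words. -/

section AlmostSure

variable {A : Type*} [Fintype A] [MeasurableSpace A]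

theorem ae_prob_prefixEvent_ne_zero (P : Measure (ℕ → A)) :
    ∀ᵐ ω ∂P, ∀ n, P (prefixEvent n ω) ≠ 0 := by
  rw [ae_all_iff]
  intro n
  have h : ∀ w : Fin n → A, ∀ᵐ ω ∂P, P (wordAt 0 w) = 0 → ω ∉ wordAt 0 w := by
    intro w
    by_cases hw : P (wordAt 0 w) = 0
    · filter_upwards [measure_eq_zero_iff_ae_notMem.1 hw] with ω hω _ using hω
    · simp [hw]
  filter_upwards [ae_all_iff.2 h] with ω hω h0
  exact hω (subword ω 0 n) h0 (mem_prefixEvent_iff.2 fun _ _ => rfl)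

omit [Fintype A] in
theorem IsStationaryLaw.prob_wordAt [Finite A] [MeasurableSingletonClass A]
    {P : Measure (ℕ → A)} (hP : IsStationaryLaw P) {r : ℕ} (a : Fin r → A) (j : ℕ) :
    P (wordAt j a) = P (wordAt 0 a) := by
  induction j with
  | zero => rfl
  | succ j ih =>
    have hm : Measurable (fun (ω : ℕ → A) i => ω (i + 1)) :=
      measurable_pi_lambda _ fun i => measurable_pi_apply _
    rw [← ih]
    conv_rhs => rw [← hP]
    rw [Measure.map_apply hm (measurableSet_wordAt _ _)]
    congr 1
    ext ω
    simp only [wordAt, Set.mem_ofPred_eq, Set.mem_preimage]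
    exact forall_congr' fun t => by rw [add_right_comm]

/-- Typicality says nothing about words of probability zero; by stationarity these almost surely
appear at no position. -/
theorem ae_wordCount_eq_zero [MeasurableSingletonClass A] {P : Measure (ℕ → A)}
    (hP : IsStationaryLaw P) :
    ∀ᵐ ω ∂P, ∀ (r : ℕ) (a : Fin r → A), P (wordAt 0 a) = 0 → ∀ n, wordCount n a ω = 0 := by
  rw [ae_all_iff]
  intro r
  rw [ae_all_iff]
  intro a
  by_cases ha : P (wordAt 0 a) = 0
  · have h : ∀ j, ∀ᵐ ω ∂P, ω ∉ wordAt j a := fun j =>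
      measure_eq_zero_iff_ae_notMem.1 ((hP.prob_wordAt a j).trans ha)
    filter_upwards [ae_all_iff.2 h] with ω hω _ n
    exact Finset.sum_eq_zero fun j _ => Set.indicator_of_notMem (hω j) _
  · simp [ha]

omit [Fintype A] in
theorem transCount_eq_zero_of_prob_ne_zero {P : Measure (ℕ → A)} {r : ℕ}
    {p : (Fin r → A) → PMF A}
    (hp : ∀ (m : ℕ) (x : ℕ → A), P (prefixEvent (r + m) x) =
      P (prefixEvent r x) * ∏ j ∈ Finset.range m, p (subword x j r) (x (j + r)))
    {m : ℕ} {ω : ℕ → A} (hω : P (prefixEvent (r + m) ω) ≠ 0) (a : Fin r → A) (b : A)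
    (hab : p a b = 0) : transCount (r + m) r ω a b = 0 := by
  classical
  rw [hp] at hω
  have h := Finset.prod_ne_zero_iff.1 (right_ne_zero_of_mul hω)
  rw [transCount, Finset.card_eq_zero, Finset.filter_eq_empty_iff, Nat.add_sub_cancel_left]
  rintro j hj ⟨rfl, rfl⟩
  exact h j hj hab

theorem exists_pos_le_of_ne_zero {ι : Type*} [Finite ι] (f : ι → ENNReal) :
    ∃ ε : ℝ, 0 < ε ∧ ∀ i, f i ≠ 0 → ENNReal.ofReal ε ≤ f i := by
  have : Fintype ι := Fintype.ofFinite ι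
  -- The value 1 is a positive filler at the indices where f is 0 or ⊤, so that the minimum of g is
  -- positive.
  let g : ι → ℝ := fun i => if f i = 0 ∨ f i = ⊤ then 1 else (f i).toReal
  have hg : ∀ i, 0 < g i := fun i => by
    by_cases h : f i = 0 ∨ f i = ⊤
    · simp [g, h]
    · simp only [g, h, if_false]
      push Not at h
      exact ENNReal.toReal_pos h.1 h.2
  rcases isEmpty_or_nonempty ι with hι | hι
  · exact ⟨1, one_pos, fun i => isEmptyElim i⟩
  · obtain ⟨i₀, hi₀⟩ := Finite.exists_min g
    refine ⟨g i₀, hg i₀, fun i hi => ?_⟩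
    by_cases h : f i = ⊤
    · simp [h]
    · refine (ENNReal.ofReal_le_ofReal (hi₀ i)).trans_eq ?_
      simp [g, hi, h]

/-- The words of positive probability have at least exponentially small probability. -/
theorem exists_exp_le_prob_prefixEvent {P : Measure (ℕ → A)} {r₀ : ℕ}
    (hP : P ∈ markovLaws A r₀) :
    ∃ C : ℝ, 0 ≤ C ∧ ∀ r, r₀ ≤ r → ∀ ω : ℕ → A, P (prefixEvent r ω) ≠ 0 →
      ENNReal.ofReal (Real.exp (-(C * (r + 1)))) ≤ P (prefixEvent r ω) := by
  obtain ⟨-, p, hp⟩ := hP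
  obtain ⟨ε₁, hε₁, h₁⟩ := exists_pos_le_of_ne_zero fun w : Fin r₀ → A => P (wordAt 0 w)
  obtain ⟨ε₂, hε₂, h₂⟩ := exists_pos_le_of_ne_zero fun t : (Fin r₀ → A) × A => p t.1 t.2
  -- A lower bound for every nonzero initial or transition probability. A word of length r ≥ r₀ uses
  -- at most r + 1 such factors, whence C = -log ε.
  set ε := min 1 (min ε₁ ε₂) with hε
  have hε0 : 0 < ε := by simp [hε, hε₁, hε₂]
  have hε1 : ε ≤ 1 := min_le_left _ _
  have e₁ : ε ≤ ε₁ := (min_le_right _ _).trans (min_le_left _ _)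
  have e₂ : ε ≤ ε₂ := (min_le_right _ _).trans (min_le_right _ _)
  refine ⟨-Real.log ε, neg_nonneg.2 (Real.log_nonpos hε0.le hε1), fun r hr ω hω => ?_⟩
  obtain ⟨m, rfl⟩ := Nat.exists_eq_add_of_le hr
  rw [hp] at hω ⊢
  have hprod := Finset.prod_ne_zero_iff.1 (right_ne_zero_of_mul hω)
  have hexp : Real.exp (-(-Real.log ε * (((r₀ + m : ℕ) : ℝ) + 1))) = ε ^ (r₀ + m + 1) := by
    rw [neg_mul, neg_neg, Real.exp_mul, Real.exp_log hε0, ← Nat.cast_add_one, Real.rpow_natCast]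
  calc ENNReal.ofReal (Real.exp (-(-Real.log ε * (((r₀ + m : ℕ) : ℝ) + 1))))
      ≤ ENNReal.ofReal (ε * ε ^ m) := by
        rw [hexp, ← pow_succ']
        exact ENNReal.ofReal_le_ofReal (pow_le_pow_of_le_one hε0.le hε1 (by omega))
    _ = ENNReal.ofReal ε * ∏ _j ∈ Finset.range m, ENNReal.ofReal ε := by
        rw [ENNReal.ofReal_mul hε0.le, ENNReal.ofReal_pow hε0.le, Finset.prod_const,
          Finset.card_range]
    _ ≤ _ := by
        refine mul_le_mul' ((ENNReal.ofReal_le_ofReal e₁).trans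
          (h₁ _ (left_ne_zero_of_mul hω))) (Finset.prod_le_prod' fun j hj => ?_)
        exact (ENNReal.ofReal_le_ofReal e₂).trans (h₂ (_, _) (hprod j hj))

end AlmostSure

/-! ### Exceptional events and Borel-Cantelli. -/

open Classical in
/-- A supermartingale functional of the counts of independent letters of law `q` whose logarithm
dominates a multiple of the total entropy of the counts. -/
theorem exists_count_functional {A : Type*} [Fintype A] [Nonempty A] (q : PMF A) (m : ℝ) {s : ℝ}
    (hs : 0 < s) :
    ∃ F : (A → ℕ) → ℝ, (∀ c, 0 < F c) ∧ F 0 ≤ 1 ∧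
      (∀ c, ∑ b, (q b).toReal * F (c + Pi.single b 1) ≤ F c) ∧
      ∀ c : A → ℕ, (∀ b, q b = 0 → c b = 0) → s * m ≤ (∑ b, c b : ℕ) → (∑ b, c b : ℕ) ≤ m →
        ∑ b, poissonEntropy (c b) ((∑ b, c b : ℕ) * (q b).toReal) ≤
          8 / s * Fintype.card A * (Real.log (F c) + Real.log (8 * Fintype.card A)) := by
  choose G hGpos hG0 hGstep hG using fun b =>
    exists_mixture (p := (q b).toReal) ENNReal.toReal_nonneg m hs
  have hA : (0 : ℝ) < Fintype.card A := by exact_mod_cast Fintype.card_pos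
  -- The counts of different letters of one context are dependent, so their functionals are
  -- averaged, not multiplied. The price is a factor |A|, since each letter is bounded by the full
  -- log F.
  refine ⟨fun c => (Fintype.card A : ℝ)⁻¹ * ∑ b, G b (c b) (∑ b, c b), ?_, ?_, ?_, ?_⟩
  · exact fun c => mul_pos (inv_pos.2 hA)
      (Finset.sum_pos (fun b _ => hGpos b _ _) Finset.univ_nonempty)
  · rw [inv_mul_le_iff₀ hA, mul_one]
    simp only [Pi.zero_apply, Finset.sum_const_zero]
    refine (Finset.sum_le_sum fun b _ => hG0 b).trans_eq ?_
    simp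
  · intro c
    have hsum : ∀ b, ∑ b', (c + (Pi.single b 1 : A → ℕ)) b' = ∑ b', c b' + 1 := fun b => by
      simp [Finset.sum_add_distrib]
    simp only [hsum]
    simp only [mul_left_comm _ (Fintype.card A : ℝ)⁻¹, Finset.mul_sum]
    rw [Finset.sum_comm]
    refine Finset.sum_le_sum fun b' _ => ?_
    rw [← Finset.mul_sum]
    refine mul_le_mul_of_nonneg_left ?_ (inv_pos.2 hA).le
    refine le_trans (le_of_eq ?_) (hGstep b' (c b') (∑ b, c b))
    have hq := PMF.sum_toReal_eq_one q
    rw [← Finset.add_sum_erase _ _ (Finset.mem_univ b')] at hq ⊢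
    rw [← eq_sub_iff_add_eq'] at hq
    rw [← hq, Finset.sum_mul]
    congr 1
    · simp
    · refine Finset.sum_congr rfl fun b hb => ?_
      simp [Pi.single_eq_of_ne (Finset.ne_of_mem_erase hb).symm]
  · intro c hc h1 h2
    set N := ∑ b, c b with hN
    set Φ := (Fintype.card A : ℝ)⁻¹ * ∑ b, G b (c b) N with hΦ
    have key : ∀ b, poissonEntropy (c b) (N * (q b).toReal) ≤
        8 / s * (Real.log Φ + Real.log (8 * Fintype.card A)) := by
      intro b
      have hb := hG b (c b) N (Finset.single_le_sum (fun _ _ => Nat.zero_le _) (Finset.mem_univ b))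
        (fun h => hc b (((ENNReal.toReal_eq_zero_iff _).1 h).resolve_right (q.apply_ne_top b)))
        h1 h2
      have hle : G b (c b) N ≤ Φ * Fintype.card A := by
        rw [hΦ, mul_comm, mul_inv_cancel_left₀ hA.ne']
        exact Finset.single_le_sum (f := fun b => G b (c b) N) (fun b _ => (hGpos b _ _).le)
          (Finset.mem_univ b)
      have hΦpos : 0 < Φ := pos_of_mul_pos_left ((hGpos b _ _).trans_le hle) hA.le
      have h3 : Real.exp (s / 8 * poissonEntropy (c b) (N * (q b).toReal)) ≤
          Φ * (8 * Fintype.card A) := by linarith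
      have h4 := Real.log_le_log (Real.exp_pos _) h3
      rw [Real.log_exp, Real.log_mul hΦpos.ne' (by positivity)] at h4
      have h5 := mul_le_mul_of_nonneg_left h4 (by positivity : 0 ≤ 8 / s)
      have h6 : 8 / s * (s / 8 * poissonEntropy (c b) (N * (q b).toReal)) =
        poissonEntropy (c b) (N * (q b).toReal) := by field_simp
      rwa [h6] at h5
    refine (Finset.sum_le_sum fun b _ => key b).trans_eq ?_
    rw [Finset.sum_const, Finset.card_univ, nsmul_eq_mul]
    ring

/-- Outside an event of probability at most `1 / K`, the total entropy of the transition counts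
is controlled by `log K`, as long as the numbers of visits to the contexts are of order `m`. -/
theorem exists_exceptional_set {A : Type*} [Fintype A] [Nonempty A] [MeasurableSpace A]
    [MeasurableSingletonClass A] {P : Measure (ℕ → A)} [IsProbabilityMeasure P] {r : ℕ}
    {p : (Fin r → A) → PMF A}
    (hp : ∀ (m : ℕ) (x : ℕ → A), P (prefixEvent (r + m) x) =
      P (prefixEvent r x) * ∏ j ∈ Finset.range m, p (subword x j r) (x (j + r)))
    (m : (Fin r → A) → ℝ) {s : ℝ} (hs : 0 < s) {K : ℝ} (hK : 0 < K) (T : ℕ) :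
    ∃ E : Set (ℕ → A), P E ≤ ENNReal.ofReal K⁻¹ ∧ ∀ ω ∉ E, ∀ n ≤ T,
      (∀ a, s * m a ≤ wordCount n a ω ∧ wordCount n a ω ≤ m a) →
      (∀ a b, p a b = 0 → transCount n r ω a b = 0) →
      ∑ a, ∑ b, poissonEntropy (transCount n r ω a b) (wordCount n a ω * (p a b).toReal) ≤
        8 / s * Fintype.card A * (Real.log K +
          (Fintype.card A) ^ r * Real.log (8 * Fintype.card A)) := by
  choose F hFpos hF0 hFstep hF using fun a => exists_count_functional (p a) (m a) hs
  refine ⟨{ω | ∃ l ≤ T, ENNReal.ofReal K ≤ ENNReal.ofReal (∏ a, F a (transCount l r ω a))},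
    ?_, fun ω hω n hn hm hsupp => ?_⟩
  · rw [ENNReal.ofReal_inv_of_pos hK, ← one_div, ENNReal.le_div_iff_mul_le]
    · exact prob_exists_le_prod_mul_le hp F (fun a c => (hFpos a c).le) hF0 hFstep _ T
    · simp [hK]
    · simp
  · have hlt : ∏ a, F a (transCount n r ω a) < K := by
      by_contra! h
      exact hω ⟨n, hn, ENNReal.ofReal_le_ofReal h⟩
    have hlog := Real.log_le_log (Finset.prod_pos fun a _ => hFpos a _) hlt.le
    rw [Real.log_prod fun a _ => (hFpos a _).ne'] at hlog
    have h1 : ∀ a, ∑ b, poissonEntropy (transCount n r ω a b)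
        (wordCount n a ω * (p a b).toReal) ≤ 8 / s * Fintype.card A *
          (Real.log (F a (transCount n r ω a)) + Real.log (8 * Fintype.card A)) := by
      intro a
      have := hF a (transCount n r ω a) (hsupp a)
      rw [sum_transCount] at this
      exact this (hm a).1 (hm a).2
    refine (Finset.sum_le_sum fun a _ => h1 a).trans ?_
    rw [← Finset.mul_sum, Finset.sum_add_distrib, Finset.sum_const, Finset.card_univ,
      Fintype.card_fun, Fintype.card_fin, nsmul_eq_mul, Nat.cast_pow]
    gcongr

/-- Borel-Cantelli over dyadic blocks of times and over all orders `r ≥ 1`. -/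
theorem ae_eventually_notMem_of_le {Ω : Type*} [MeasurableSpace Ω] {P : Measure Ω}
    {E : ℕ → ℕ → Set Ω}
    (hE : ∀ k r, P (E k r) ≤ ENNReal.ofReal (((k : ℝ) + 1) ^ 2 * 2 ^ r)⁻¹) :
    ∀ᵐ ω ∂P, ∀ᶠ k in atTop, ∀ r, ω ∉ E k r := by
  have hk : ∀ k, P (⋃ r, E k r) ≤ ENNReal.ofReal (2 * (((k + 1 : ℕ) : ℝ) ^ 2)⁻¹) := by
    intro k
    have hsum : HasSum (fun r : ℕ => (((k : ℝ) + 1) ^ 2 * 2 ^ r)⁻¹)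
        (2 * (((k + 1 : ℕ) : ℝ) ^ 2)⁻¹) := by
      have h : (fun r : ℕ => (((k : ℝ) + 1) ^ 2 * 2 ^ r)⁻¹) =
          fun r : ℕ => (1 / 2 : ℝ) ^ r * (((k + 1 : ℕ) : ℝ) ^ 2)⁻¹ := by
        funext r
        rw [mul_inv, mul_comm, one_div, inv_pow, Nat.cast_succ]
      rw [h]
      exact hasSum_geometric_two.mul_right _
    refine (measure_iUnion_le _).trans ((ENNReal.tsum_le_tsum (hE k)).trans_eq ?_)
    rw [← ENNReal.ofReal_tsum_of_nonneg (fun r => by positivity) hsum.summable, hsum.tsum_eq]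
  have hfin : ∑' k, P (⋃ r, E k r) ≠ ⊤ := by
    refine ne_top_of_le_ne_top ?_ (ENNReal.tsum_le_tsum hk)
    refine Summable.tsum_ofReal_ne_top (Summable.mul_left _ ?_)
    exact (summable_nat_add_iff 1 (f := fun k : ℕ => ((k : ℝ) ^ 2)⁻¹)).2
      (Real.summable_nat_pow_inv.2 one_lt_two)
  filter_upwards [ae_eventually_notMem hfin] with ω hω
  filter_upwards [hω] with k hk r hr
  exact hk (Set.mem_iUnion.2 ⟨r, hr⟩)

/-- Almost surely, for all large `k` and all `r > r₀` and all times up to `2 ^ (k + 1)`, the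
likelihood ratio of the chains of order `r` with respect to `P` is at most the exponential of
`|A| ^ r` times a multiple of `log k`, as long as the context counts are of order `m k r`. -/
theorem ae_eventually_likelihood_ratio_le {A : Type*} [Fintype A] [Nontrivial A]
    [MeasurableSpace A] [MeasurableSingletonClass A] {P : Measure (ℕ → A)} {r₀ : ℕ}
    (hP : P ∈ markovLaws A r₀) (m : ℕ → ∀ r : ℕ, (Fin r → A) → ℝ) {s : ℝ} (hs : 0 < s) :
    ∃ C : ℝ, ∀ᵐ ω ∂P, ∀ᶠ k : ℕ in atTop, ∀ r, r₀ < r → ∀ n, r ≤ n → n ≤ 2 ^ (k + 1) →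
      (∀ a, s * m k r a ≤ wordCount n a ω ∧ wordCount n a ω ≤ m k r a) →
      ∀ Q ∈ markovLaws A r, Q (prefixEvent n ω) ≤
        ENNReal.ofReal (Real.exp ((Fintype.card A : ℝ) ^ r *
          (16 / s * Real.log (k + 1) + C))) * P (prefixEvent n ω) := by
  have := hP.1
  obtain ⟨C₁, hC₁, hlow⟩ := exists_exp_le_prob_prefixEvent hP
  choose p hp using fun r : {r // r₀ < r} => (markovLaws_mono r.2.le hP).2
  have hA2 : 2 ≤ Fintype.card A := Fintype.one_lt_card
  have hA2' : (2 : ℝ) ≤ Fintype.card A := by exact_mod_cast hA2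
  -- The exponent carries |A|^(r-1), not |A|^r: the factor |A| in `exists_exceptional_set` restores
  -- |A|^r and leaves the coefficient of log(k+1) free of |A|. Only r > r₀ matters, so r ≥ 1 and the
  -- subtraction is genuine.
  let K : ℕ → ℕ → ℝ := fun k r => ((k : ℝ) + 1) ^ (2 * Fintype.card A ^ (r - 1)) * 2 ^ r
  have hK : ∀ k r, 0 < K k r := fun k r => by positivity
  choose E hE hEb using fun (k : ℕ) (r : {r // r₀ < r}) =>
    exists_exceptional_set (hp r) (m k r) hs (hK k r) (2 ^ (k + 1))
  let E' : ℕ → ℕ → Set (ℕ → A) := fun k r => if h : r₀ < r then E k ⟨r, h⟩ else ∅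
  have hE' : ∀ k r, P (E' k r) ≤ ENNReal.ofReal (((k : ℝ) + 1) ^ 2 * 2 ^ r)⁻¹ := by
    intro k r
    by_cases h : r₀ < r
    · simp only [E', h, dif_pos]
      refine (hE k ⟨r, h⟩).trans (ENNReal.ofReal_le_ofReal ?_)
      apply inv_anti₀ (by positivity)
      refine mul_le_mul_of_nonneg_right (pow_le_pow_right₀ ?_ ?_) (by positivity)
      · linarith [(Nat.cast_nonneg k : (0:ℝ) ≤ k)]
      · have := Nat.one_le_pow (r - 1) (Fintype.card A) (by omega)
        exact Nat.mul_le_mul_left 2 this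
    · simp [E', h]
  refine ⟨8 / s + 8 / s * (Fintype.card A * Real.log (8 * Fintype.card A)) + C₁, ?_⟩
  filter_upwards [ae_eventually_notMem_of_le hE', ae_prob_prefixEvent_ne_zero P] with ω hω hω0
  filter_upwards [hω] with k hk r hr n hrn hn hm Q hQ
  obtain ⟨d, rfl⟩ := Nat.exists_eq_add_of_le hrn
  have hsupp := transCount_eq_zero_of_prob_ne_zero (hp ⟨r, hr⟩) (hω0 (r + d))
  have hkr : ω ∉ E k ⟨r, hr⟩ := by simpa [E', hr] using hk r
  have hent := hEb k ⟨r, hr⟩ ω hkr (r + d) hn hm hsupp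
  have hlik := prob_prefixEvent_mul_le (hp ⟨r, hr⟩) hQ hsupp
  have hPr := hlow r hr.le ω (hω0 r)
  set V := ∑ a, ∑ b, poissonEntropy (transCount (r + d) r ω a b)
    (wordCount (r + d) a ω * (p ⟨r, hr⟩ a b).toReal) with hV
  set q : ℝ := (Fintype.card A : ℝ) with hq
  obtain ⟨t, rfl⟩ : ∃ t, r = t + 1 := ⟨r - 1, by omega⟩
  -- Terms linear in r, from 2^r in K and from the initial word, are absorbed using r ≤ |A|^(r-1)
  -- and r + 1 ≤ |A|^r, which need |A| ≥ 2.
  have hreal : V + C₁ * ((t + 1 : ℕ) + 1) ≤ q ^ (t + 1) *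
      (16 / s * Real.log (k + 1) + (8 / s + 8 / s * (q * Real.log (8 * q)) + C₁)) := by
    have hlogK : Real.log (K k (t + 1)) =
        2 * q ^ t * Real.log (k + 1) + (t + 1) * Real.log 2 := by
      simp only [K]
      rw [Real.log_mul (by positivity) (by positivity), Real.log_pow, Real.log_pow]
      push_cast
      simp [hq]
    rw [hlogK] at hent
    have hl2 : Real.log 2 ≤ 1 := by linarith [Real.log_two_lt_d9]
    have ht1 : (t : ℝ) + 1 ≤ q ^ t := by
      have h1 : t + 1 ≤ 2 ^ t := Nat.lt_two_pow_self
      have h2 : (t : ℝ) + 1 ≤ 2 ^ t := by exact_mod_cast h1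
      exact h2.trans (pow_le_pow_left₀ (by norm_num) hA2' t)
    have ht2 : (t : ℝ) + 1 + 1 ≤ q ^ (t + 1) := by
      have : (1 : ℝ) ≤ q ^ t := one_le_pow₀ (by linarith)
      rw [pow_succ]
      nlinarith
    have h3 : ((t : ℝ) + 1) * Real.log 2 ≤ q ^ t :=
      (mul_le_of_le_one_right (by positivity) hl2).trans ht1
    have h4 := mul_le_mul_of_nonneg_left h3 (by positivity : 0 ≤ 8 / s * q)
    have h5 := mul_le_mul_of_nonneg_left ht2 hC₁
    push_cast
    have e : 16 / s = 2 * (8 / s) := by ring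
    rw [e]
    rw [pow_succ] at hent h5 ⊢
    linarith
  have hexp : ENNReal.ofReal (Real.exp (-(C₁ * ((t + 1 : ℕ) + 1)))) *
      ENNReal.ofReal (Real.exp (C₁ * ((t + 1 : ℕ) + 1))) = 1 := by
    rw [← ENNReal.ofReal_mul (Real.exp_pos _).le, ← Real.exp_add]
    simp
  calc Q (prefixEvent (t + 1 + d) ω)
      = Q (prefixEvent (t + 1 + d) ω) *
        ENNReal.ofReal (Real.exp (-(C₁ * ((t + 1 : ℕ) + 1)))) *
        ENNReal.ofReal (Real.exp (C₁ * ((t + 1 : ℕ) + 1))) := by rw [mul_assoc, hexp, mul_one]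
    _ ≤ ENNReal.ofReal (Real.exp V) * P (prefixEvent (t + 1 + d) ω) *
        ENNReal.ofReal (Real.exp (C₁ * ((t + 1 : ℕ) + 1))) :=
      mul_le_mul_left ((mul_le_mul_right hPr _).trans hlik) _
    _ = ENNReal.ofReal (Real.exp (V + C₁ * ((t + 1 : ℕ) + 1))) *
        P (prefixEvent (t + 1 + d) ω) := by
      rw [mul_right_comm, ← ENNReal.ofReal_mul (Real.exp_pos _).le, ← Real.exp_add]
    _ ≤ _ := mul_le_mul_left (ENNReal.ofReal_le_ofReal (Real.exp_le_exp.2 hreal)) _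

/-! ### From likelihood ratios to the theorem. -/

/-- A uniform bound on the likelihood ratios bounds the normalized maximal log-likelihoods. -/
theorem maxLogLik_sub_div_le {A : Type*} [Fintype A] [Nonempty A] [MeasurableSpace A]
    {P : Measure (ℕ → A)} {r₀ r n : ℕ} (hP : P ∈ markovLaws A r₀) {ω : ℕ → A} {D : ℝ}
    (h : ∀ Q ∈ markovLaws A r, Q (prefixEvent n ω) ≤
      ENNReal.ofReal (Real.exp ((Fintype.card A : ℝ) ^ r * D)) * P (prefixEvent n ω)) :
    (maxLogLik r n ω - maxLogLik r₀ n ω) / ((Fintype.card A ^ r : ℕ) : EReal) ≤ (D : EReal) := by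
  have hpos : 0 < Fintype.card A ^ r := pow_pos Fintype.card_pos r
  rw [EReal.div_le_iff_le_mul (by exact_mod_cast hpos) (EReal.natCast_ne_top _)]
  apply EReal.sub_le_of_le_add
  refine iSup₂_le fun Q hQ => ?_
  refine (ENNReal.log_le_log (h Q hQ)).trans ?_
  rw [ENNReal.log_mul_add, ENNReal.log_ofReal_of_pos (Real.exp_pos _), Real.log_exp]
  refine add_le_add (le_of_eq ?_) (le_iSup₂_of_le P hP le_rfl)
  rw [EReal.coe_mul, ← Nat.cast_pow, EReal.coe_natCast]

/-- For n in the dyadic block k, κ(n) ≤ n/4 gives (3/4) 2^k ≤ n - r ≤ 2 · 2^k. Typicality multiplies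
these bounds by 1 - η and by 1 + η ≤ 2, so one reference count 4 · 2^k P(a) serves the entire block.
-/
theorem LargeScaleTypicality.ae_eventually_wordCount {A : Type*} [Fintype A] [MeasurableSpace A]
    [MeasurableSingletonClass A] {P : Measure (ℕ → A)} [IsProbabilityMeasure P]
    (hst : IsStationaryLaw P) {κ : ℕ → ℝ} (hmono : Monotone κ) (hκ : ∀ n, κ n ≤ (n : ℝ) / 4)
    {η : ℝ} (hη : η < 1) (htyp : LargeScaleTypicality P (fun n => κ (2 * n)) η) :
    ∀ᵐ ω ∂P, ∀ᶠ n : ℕ in atTop, ∀ k, 2 ^ k ≤ n → n ≤ 2 ^ (k + 1) → ∀ r : ℕ, (r : ℝ) < κ n →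
      ∀ a : Fin r → A,
        3 / 16 * (1 - η) * (4 * 2 ^ k * P.real (wordAt 0 a)) ≤ wordCount n a ω ∧
          wordCount n a ω ≤ 4 * 2 ^ k * P.real (wordAt 0 a) := by
  filter_upwards [htyp, ae_wordCount_eq_zero hst] with ω hω hω0
  filter_upwards [hω] with n hn k hk1 hk2 r hr a
  by_cases ha : P (wordAt 0 a) = 0
  · simp [hω0 r a ha n, measureReal_def, ha]
  · have hrn := hn r (hr.trans_le (hmono (by omega))) a (pos_iff_ne_zero.2 ha)
    have hpos : 0 < P.real (wordAt 0 a) := ENNReal.toReal_pos ha (measure_ne_top _ _)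
    set b := P.real (wordAt 0 a)
    set N := (wordCount n a ω : ℝ)
    have hr4 : (r : ℝ) < n / 4 := hr.trans_le (hκ n)
    have hr0 : (0 : ℝ) ≤ r := Nat.cast_nonneg r
    have hnr : 0 < (n : ℝ) - r := by linarith
    have e : 1 / b * (N / ((n : ℝ) - r)) = N / (b * (n - r)) := by field_simp
    rw [e, abs_lt] at hrn
    have h1 : (1 - η) * (b * (n - r)) ≤ N := by
      rw [← le_div_iff₀ (by positivity)]; linarith
    have h2 : N ≤ (1 + η) * (b * (n - r)) := by
      rw [← div_le_iff₀ (by positivity)]; linarith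
    have hk1' : (2 : ℝ) ^ k ≤ n := by exact_mod_cast hk1
    have hk2' : (n : ℝ) ≤ 2 * 2 ^ k := by rw [← pow_succ']; exact_mod_cast hk2
    constructor
    · refine le_trans ?_ h1
      have : b * (3 / 4 * 2 ^ k) ≤ b * (n - r) := mul_le_mul_of_nonneg_left (by linarith) hpos.le
      have := mul_le_mul_of_nonneg_left this (by linarith : 0 ≤ 1 - η)
      linarith
    · refine h2.trans ?_
      have h3 : (1 + η) * (b * (n - r)) ≤ 2 * (b * (n - r)) :=
        mul_le_mul_of_nonneg_right (by linarith) (by positivity)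
      have : b * (n - r) ≤ b * (2 * 2 ^ k) := mul_le_mul_of_nonneg_left (by linarith) hpos.le
      linarith

theorem tendsto_log_log_atTop :
    Tendsto (fun n : ℕ => Real.log (Real.log (n : ℝ))) atTop atTop :=
  Real.tendsto_log_atTop.comp (Real.tendsto_log_atTop.comp tendsto_natCast_atTop_atTop)

theorem log_natLog_add_one_le {n : ℕ} (hn : 3 ≤ n) :
    Real.log (Nat.log 2 n + 1) ≤ Real.log (Real.log n) + Real.log 3 := by
  have hn' : (3 : ℝ) ≤ n := by exact_mod_cast hn
  have h1 : 1 ≤ Real.log n := by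
    rw [Real.le_log_iff_exp_le (by linarith)]
    linarith [Real.exp_one_lt_d9]
  have h2 : (Nat.log 2 n : ℝ) * Real.log 2 ≤ Real.log n := by
    rw [← Real.log_pow]
    refine Real.log_le_log (by positivity) ?_
    exact_mod_cast Nat.pow_log_le_self 2 (by omega)
  rw [← Real.log_mul (by linarith) (by norm_num)]
  refine Real.log_le_log (by positivity) ?_
  nlinarith [Real.log_two_gt_d9, (Nat.cast_nonneg (Nat.log 2 n) : (0 : ℝ) ≤ Nat.log 2 n)]

theorem theorem1 (η : ℝ) (hη : η < 1) :
    ∃ C₀ : ℝ, 0 < C₀ ∧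
      ∀ (A : Type*) [Fintype A] [MeasurableSpace A] [MeasurableSingletonClass A]
        (P : Measure (ℕ → A)) (rstar : ℕ) (κ : ℕ → ℝ),
        IsMarkovOfOrder P rstar →
        IsStationaryLaw P →
        IsIrreducibleLaw P rstar →
        Monotone κ →
        (∀ n : ℕ, κ n ≤ (n : ℝ) / 4) →
        LargeScaleTypicality P (fun n => κ (2 * n)) η →
        ∀ᵐ ω ∂P, ∀ᶠ n : ℕ in atTop,
          (⨆ r : ℕ, ⨆ _ : rstar < r ∧ (r : ℝ) < κ n,
            (maxLogLik r n ω - maxLogLik rstar n ω) / ((Fintype.card A ^ r : ℕ) : EReal))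
          ≤ ((C₀ * Real.log (Real.log (n : ℝ)) : ℝ) : EReal) := by
  set s : ℝ := 3 / 16 * (1 - η) with hs_def
  have hs : 0 < s := by rw [hs_def]; linarith
  -- 16/s comes from the likelihood bound; the extra 1/s absorbs, for large n, the constants that
  -- depend on P.
  refine ⟨17 / s, by positivity, ?_⟩
  intro A _ _ _ P rstar κ hord hst _ hmono hκ htyp
  have hP : P ∈ markovLaws A rstar := hord.1
  have := hP.1
  obtain ⟨ω₀⟩ : Nonempty (ℕ → A) := P.nonempty_of_neZero
  have : Nonempty A := ⟨ω₀ 0⟩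
  -- With a single letter every prefix has probability one and all likelihoods agree. The general
  -- bound is stated for |A| ≥ 2.
  rcases subsingleton_or_nontrivial A with hA | hA
  · refine Eventually.of_forall fun ω => ?_
    filter_upwards [tendsto_log_log_atTop.eventually_ge_atTop 0] with n hn
    refine iSup₂_le fun r _ => maxLogLik_sub_div_le hP fun Q hQ => ?_
    have := hQ.1
    have huniv : prefixEvent n ω = Set.univ :=
      Set.eq_univ_of_forall fun x => mem_prefixEvent_iff.2 fun _ _ => Subsingleton.elim _ _
    rw [huniv, measure_univ, measure_univ, mul_one, ENNReal.one_le_ofReal]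
    exact Real.one_le_exp (by positivity)
  · obtain ⟨C, hC⟩ := ae_eventually_likelihood_ratio_le hP
      (fun k r a => 4 * 2 ^ k * P.real (wordAt 0 a)) hs
    filter_upwards [hC, LargeScaleTypicality.ae_eventually_wordCount hst hmono hκ hη htyp]
      with ω hω hcount
    have hlog : Tendsto (Nat.log 2) atTop atTop :=
      tendsto_atTop_atTop.2 fun b => ⟨2 ^ b, fun n hn =>
        (Nat.log_pow one_lt_two b).symm.le.trans (Nat.log_mono_right hn)⟩
    filter_upwards [hlog.eventually hω, hcount, eventually_ge_atTop 3,
      tendsto_log_log_atTop.eventually_ge_atTop ((16 / s * Real.log 3 + C) * s)]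
      with n hn hcn hn3 hll
    have hk1 : 2 ^ Nat.log 2 n ≤ n := Nat.pow_log_le_self 2 (by omega)
    have hk2 : n ≤ 2 ^ (Nat.log 2 n + 1) := (Nat.lt_pow_succ_log_self one_lt_two n).le
    refine iSup₂_le fun r hr => ?_
    have hrn : r ≤ n := by
      have h1 : (r : ℝ) < n / 4 := hr.2.trans_le (hκ n)
      have h2 : (r : ℝ) ≤ n := by linarith [(Nat.cast_nonneg n : (0 : ℝ) ≤ n)]
      exact_mod_cast h2
    refine (maxLogLik_sub_div_le hP
      (hn r hr.1 n hrn hk2 (hcn _ hk1 hk2 r hr.2))).trans (EReal.coe_le_coe_iff.2 ?_)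
    have h1 := mul_le_mul_of_nonneg_left (log_natLog_add_one_le hn3) (by positivity : 0 ≤ 16 / s)
    have h2 : 16 / s * Real.log 3 + C ≤ 1 / s * Real.log (Real.log n) := by
      rw [one_div, ← div_eq_inv_mul, le_div_iff₀ hs]
      exact hll
    have e : 17 / s = 16 / s + 1 / s := by ring
    rw [e]
    linarith
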